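/- Let $G$ be a complex Hilbert space, let $\mathcal{B}\subset\mathcal{B}(G)$ be a von Neumann algebra (with $\mathrm{id}_G\in\mathcal{B}$), and let $T:\mathcal{B}\to\mathcal{B}$ be a normal completely positive linear map, where normal means that $T$ preserves suprema of bounded increasing nets. Let $(E,\xi)$ be the strongly closed GNS-construction of $T$, defined as follows. Let $H$ be the Hilbert space obtained (by dividing out the vectors of length zero and completing) from the formal linear combinations of symbols $a\odot g$ ($a\in\mathcal{B}$, $g\in G$) with the semi-inner product determined by $\langle a\odot g,a'\odot g'\rangle=\langle g,T(a^*a')g'\rangle$. Let $\mathcal{B}$ act on $H$ by $b(a\odot g)=(ba)\odot g$, and let $\xi\in\mathcal{B}(G,H)$ be the operator $g\mapsto \mathrm{id}_G\odot g$. Then $E$ is the closure of $\operatorname{span}\{a\xi b: a,b\in\mathcal{B}\}$ in the strong operator topology of $\mathcal{B}(G,H)$, with inner product $\langle x,y\rangle=x^*y$ and with left and right actions of $\mathcal{B}$ by composition; thus $T(b)=\langle\xi,b\xi\rangle$ for all $b\in\mathcal B$. Let $\mathcal{B}^a(E)$ be the $*$-algebra of adjointable operators on $E$, that is, of the maps $a:E\to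 E$ for which there is a map $a^*:E\to E$ with $\langle a^*x,y\rangle=\langle x,ay\rangle$ for all $x,y\in E$. Let $C\ni\mathrm{id}_G$ be a maximal commutative von Neumann subalgebra of $\mathcal{B}$, that is, $C\subset\mathcal{B}$ is commutative and no strictly larger von Neumann subalgebra of $\mathcal{B}$ is commutative. **Theorem 3.1.** $T(C)\subset C$ if and only if there exists a $*$-map $\alpha:C\to\mathcal{B}^a(E)$ (a map with $\alpha(c^*)=\alpha(c)^*$ for all $c\in C$) such that 1. $c_1\,\alpha(c_2)x=\alpha(c_2)\,c_1x$ for all $c_1,c_2\in C$ and all $x\in E$; 2. $\alpha(c)\xi=c\xi-\xi c$ for all $c\in C$. -/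

import Mathlib

open scoped CStarAlgebra InnerProductSpace

namespace VonNeumannAlgebra

variable {G : Type*} [NormedAddCommGroup G] [InnerProductSpace ℂ G] [CompleteSpace G]

instance instSMulMemClass : SMulMemClass (VonNeumannAlgebra G) ℂ (G →L[ℂ] G) where
  smul_mem {B} r _ hb := B.toStarSubalgebra.smul_mem hb r

instance instIsClosed (B : VonNeumannAlgebra G) : IsClosed (B : Set (G →L[ℂ] G)) := by
  rw [← B.centralizer_centralizer]
  exact Set.isClosed_centralizer _

/-- The positive square root of a positive element of `B` lies in `B`. -/
theorem sqrt_mem (B : VonNeumannAlgebra G) {b : G →L[ℂ] G} (hb : b ∈ B) :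
    CFC.sqrt b ∈ B := by
  rw [← SetLike.mem_coe, ← B.centralizer_centralizer]
  intro x hx
  have : Commute b x := hx b hb
  have := this.cfcₙ_nnreal NNReal.sqrt
  exact (this).symm

/-- With the order inherited from the Loewner order of `B(G)`, the C*-algebra `B` is a star-ordered
ring, so that Mathlib's completely positive maps `B →CP B` make sense. -/
instance instStarOrderedRing (B : VonNeumannAlgebra G) : StarOrderedRing B :=
  .of_nonneg_iff' (fun {x y} h z => by
      rw [← Subtype.coe_le_coe] at h ⊢
      exact add_le_add_right h z.1)
    (fun x => by
      rw [← Subtype.coe_le_coe]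
      constructor
      · intro h
        refine ⟨⟨CFC.sqrt x.1, B.sqrt_mem x.2⟩, Subtype.ext ?_⟩
        change x.1 = star (CFC.sqrt x.1) * CFC.sqrt x.1
        rw [(CFC.sqrt_nonneg x.1).isSelfAdjoint.star_eq, CFC.sqrt_mul_sqrt_self x.1 h]
      · rintro ⟨s, rfl⟩
        exact star_mul_self_nonneg s.1)

/-- `C` is a maximal commutative von Neumann subalgebra of `B`: it is commutative, contained in `B`,
and no strictly larger von Neumann subalgebra of `B` is commutative. (Every `VonNeumannAlgebra G`
contains the identity operator of `G`.) -/
def IsMaximalCommutative (C B : VonNeumannAlgebra G) : Prop :=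
  Maximal (fun D : VonNeumannAlgebra G => D ≤ B ∧ ∀ x ∈ D, ∀ y ∈ D, x * y = y * x) C

end VonNeumannAlgebra

section Operators

variable {G H : Type*} [NormedAddCommGroup G] [InnerProductSpace ℂ G]
  [NormedAddCommGroup H] [InnerProductSpace ℂ H]

/-- The closure of a linear space `S` of bounded operators in the strong operator topology, that is,
in the topology of pointwise convergence on `G`. -/
def strongClosure (S : Submodule ℂ (G →L[ℂ] H)) : Submodule ℂ (G →L[ℂ] H) :=
  let toFunₗ : (G →L[ℂ] H) →ₗ[ℂ] (G → H) :=
    { toFun := fun x => x, map_add' := fun _ _ => rfl, map_smul' := fun _ _ => rfl }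
  (S.map toFunₗ).topologicalClosure.comap toFunₗ

theorem mem_strongClosure {S : Submodule ℂ (G →L[ℂ] H)} {x : G →L[ℂ] H} :
    x ∈ strongClosure S ↔
      (x : G → H) ∈ closure ((fun y : G →L[ℂ] H => (y : G → H)) '' (S : Set (G →L[ℂ] H))) :=
  Iff.rfl

theorem subset_strongClosure {S : Submodule ℂ (G →L[ℂ] H)} : S ≤ strongClosure S :=
  fun x hx => subset_closure ⟨x, hx, rfl⟩

theorem strongClosure_comp_mem {S : Submodule ℂ (G →L[ℂ] H)} (r : H →L[ℂ] H) (b : G →L[ℂ] G)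
    (h : ∀ x ∈ S, r ∘L x ∘L b ∈ S) {x : G →L[ℂ] H} (hx : x ∈ strongClosure S) :
    r ∘L x ∘L b ∈ strongClosure S := by
  have hc : Continuous fun f : G → H => fun g => r (f (b g)) := by fun_prop
  change ((r ∘L x ∘L b : G →L[ℂ] H) : G → H) ∈
    closure ((fun y : G →L[ℂ] H => (y : G → H)) '' (S : Set (G →L[ℂ] H)))
  refine map_mem_closure (f := fun (f : G → H) (g : G) => r (f (b g))) hc
    (mem_strongClosure.mp hx) ?_
  rintro _ ⟨y, hy, rfl⟩
  exact ⟨_, h y hy, rfl⟩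

/-- The algebra `B^a(E)` of adjointable operators on a space `E ⊆ B(G, H)` carrying the
operator-valued inner product `⟪x, y⟫ = x⋆ y`: maps `a` on `E` together with their (unique) adjoint,
i.e. a map `a⋆` on `E` such that `⟪a⋆ x, y⟫ = ⟪x, a y⟫` for all `x, y ∈ E`. -/
structure AdjointableOperator [CompleteSpace G] [CompleteSpace H]
    (E : Submodule ℂ (G →L[ℂ] H)) where
  toFun : E → E
  adj : E → E
  inner_adj : ∀ x y : E, (adj x : G →L[ℂ] H).adjoint ∘L (y : G →L[ℂ] H)
    = (x : G →L[ℂ] H).adjoint ∘L (toFun y : G →L[ℂ] H)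

namespace AdjointableOperator

variable [CompleteSpace G] [CompleteSpace H] {E : Submodule ℂ (G →L[ℂ] H)}

instance : CoeFun (AdjointableOperator E) (fun _ => E → E) := ⟨toFun⟩

/-- An adjointable operator is determined by its underlying map: the adjoint is unique. -/
@[ext]
theorem ext {a b : AdjointableOperator E} (h : ∀ x, a x = b x) : a = b := by
  have hf : a.toFun = b.toFun := funext h
  have hadj : a.adj = b.adj := by
    funext x
    apply Subtype.ext
    have key : ∀ y : E, ((a.adj x : G →L[ℂ] H) - b.adj x).adjoint ∘L (y : G →L[ℂ] H) = 0 := by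
      intro y
      rw [map_sub, ContinuousLinearMap.sub_comp, a.inner_adj, b.inner_adj, hf, sub_self]
    have h0 := key (a.adj x - b.adj x)
    rw [Submodule.coe_sub] at h0
    rw [← sub_eq_zero, ← norm_eq_zero, ← mul_self_eq_zero,
      ← ContinuousLinearMap.norm_adjoint_comp_self, h0, norm_zero]
  cases a; cases b
  simp_all

/-- The involution of `B^a(E)`. -/
instance : Star (AdjointableOperator E) where
  star a :=
    { toFun := a.adj
      adj := a.toFun
      inner_adj := fun x y => by
        have h := congrArg ContinuousLinearMap.adjoint (a.inner_adj y x)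
        simpa [ContinuousLinearMap.adjoint_comp] using h.symm }

end AdjointableOperator

end Operators

namespace CPMap

variable {G : Type*} [NormedAddCommGroup G] [InnerProductSpace ℂ G] [CompleteSpace G]
variable {B : VonNeumannAlgebra G} (T : B →CP B)

/-- The completely positive map `T` is normal, i.e. it preserves the suprema of bounded increasing
nets. -/
def IsNormal : Prop := ScottContinuous T

/-- The operator-valued kernel `(a, b) ↦ T (a⋆ b)` on `B`. -/
noncomputable def kernel : Matrix B B (G →L[ℂ] G) :=
  .of fun a b => (T (star a * b) : G →L[ℂ] G)

theorem kernel_apply (a b : B) : kernel T a b = (T (star a * b) : G →L[ℂ] G) := rfl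

theorem map_star' (a : B) : T (star a) = star (T a) := by
  let f : B →ₚ[ℂ] B := { T.toLinearMap with monotone' := OrderHomClass.mono T }
  exact map_star f a

theorem matrix_nonneg {n : Type*} [Fintype n] (M : CStarMatrix n n B) (hM : 0 ≤ M) (g : n → G) :
    0 ≤ RCLike.re (∑ i, ∑ j, ⟪g i, (M i j : G →L[ℂ] G) (g j)⟫_ℂ) := by
  rw [StarOrderedRing.nonneg_iff] at hM
  induction hM using AddSubmonoid.closure_induction with
  | zero => simp
  | add x y _ _ hx hy =>
    simpa [inner_add_right, Finset.sum_add_distrib] using add_nonneg hx hy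
  | mem x hx =>
    obtain ⟨Y, rfl⟩ := hx
    have : ∑ i, ∑ j, ⟪g i, ((star Y * Y) i j : G →L[ℂ] G) (g j)⟫_ℂ
        = ∑ k, ⟪∑ i, (Y k i : G →L[ℂ] G) (g i), ∑ j, (Y k j : G →L[ℂ] G) (g j)⟫_ℂ := by
      simp_rw [sum_inner, inner_sum]
      conv_rhs => rw [Finset.sum_comm]
      refine Finset.sum_congr rfl fun i _ => ?_
      conv_rhs => rw [Finset.sum_comm]
      refine Finset.sum_congr rfl fun j _ => ?_
      have : ((star Y * Y) i j : G →L[ℂ] G)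
          = ∑ k, star (Y k i : G →L[ℂ] G) * (Y k j : G →L[ℂ] G) := by
        rw [CStarMatrix.mul_apply]
        simp [CStarMatrix.star_apply]
      rw [this]
      simp [ContinuousLinearMap.star_eq_adjoint,
        ContinuousLinearMap.adjoint_inner_right]
    rw [this, map_sum]
    exact Finset.sum_nonneg fun k _ => inner_self_nonneg

theorem family_nonneg {n : Type*} [Fintype n] (a : n → B) (g : n → G) :
    0 ≤ RCLike.re (∑ i, ∑ j, ⟪g i, (T (star (a i) * a j) : G →L[ℂ] G) (g j)⟫_ℂ) := by
  classical
  rcases isEmpty_or_nonempty n with h | ⟨⟨k⟩⟩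
  · simp
  let R : CStarMatrix n n B := CStarMatrix.ofMatrix fun i j => if i = k then a j else 0
  have hR : ∀ i j, (star R * R) i j = star (a i) * a j := by
    intro i j
    have hRa : ∀ i j, R i j = if i = k then a j else 0 := fun _ _ => rfl
    rw [CStarMatrix.mul_apply, Finset.sum_eq_single k]
    · simp [hRa, CStarMatrix.star_apply]
    · intro l _ hl
      simp [hRa, hl]
    · simp
  have h := matrix_nonneg _ (T.map_cstarMatrix_nonneg _ (star_mul_self_nonneg R)) g
  simpa [CStarMatrix.map_apply, hR] using h

theorem kernel_posSemidef : (kernel T).PosSemidef := by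
  have tfae := (RKHS.posSemidef_tfae (K := kernel T)).out 0 2
  refine tfae.mpr ⟨?_, fun v => ?_⟩
  · ext1 a b
    rw [Matrix.conjTranspose_apply, kernel_apply, kernel_apply]
    have := congrArg (Subtype.val) (map_star' T (star b * a))
    simpa using this.symm
  · have h := family_nonneg T (fun a : v.support => a.1) (fun a => v a.1)
    simp only [Finsupp.sum]
    rw [← Finset.sum_coe_sort]
    refine h.trans_eq ?_
    rw [← RCLike.conj_re, map_sum]
    congr 1
    simp_rw [map_sum, inner_conj_symm]
    rw [Finset.sum_comm]
    refine Finset.sum_congr rfl fun x _ => ?_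
    exact Finset.sum_coe_sort v.support
      (fun y => ⟪(T (star y * x.1) : G →L[ℂ] G) (v x.1), v y⟫_ℂ)

instance : Fact (kernel T).PosSemidef := ⟨kernel_posSemidef T⟩

/-- The Hilbert space `H = E ⊙ G` on which `B` acts by the Stinespring representation: the Hausdorff
completion of the space of formal linear combinations of symbols `a ⊙ g` (`a ∈ B`, `g ∈ G`) with
respect to the semi-inner product determined by `⟪a ⊙ g, a' ⊙ g'⟫ = ⟪g, T (a⋆ a') g'⟫`. The operator
`g ↦ a ⊙ g` is `RKHS.kerFun (Space T) a`. -/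
abbrev Space := RKHS.OfKernel (kernel T)

theorem inner_def (f g : RKHS.H₀ (kernel T)) : ⟪f, g⟫_ℂ =
  f.sum fun x z ↦ g.sum fun y w ↦ star z * w * ⟪(T (star y.1 * x.1) : G →L[ℂ] G) x.2, y.2⟫_ℂ := rfl

/-- The map `a ⊙ g ↦ (b a) ⊙ g` before completion. -/
noncomputable def preMul (b : B) : RKHS.H₀ (kernel T) →ₗ[ℂ] RKHS.H₀ (kernel T) :=
  Finsupp.lmapDomain ℂ ℂ fun x => (b * x.1, x.2)

theorem inner_preMul (b c : B) (f g : RKHS.H₀ (kernel T)) : ⟪preMul T b f, preMul T c g⟫_ℂ =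
  f.sum fun x z ↦ g.sum fun y w ↦ star z * w *
    ⟪(T (star y.1 * (star c * b) * x.1) : G →L[ℂ] G) x.2, y.2⟫_ℂ := by
  rw [inner_def, preMul, preMul, Finsupp.lmapDomain_apply, Finsupp.lmapDomain_apply,
    Finsupp.sum_mapDomain_index]
  · refine Finset.sum_congr rfl fun x _ => ?_
    dsimp only
    rw [Finsupp.sum_mapDomain_index]
    · simp [mul_assoc]
    · simp
    · intros; simp [mul_add, add_mul]
  · simp
  · intros; simp [add_mul]

theorem norm_preMul_le (b : B) (f : RKHS.H₀ (kernel T)) : ‖preMul T b f‖ ≤ ‖b‖ * ‖f‖ := by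
  have h : 0 ≤ (‖b‖ ^ 2 : ℝ) • (1 : B) - star b * b := by
    rw [sub_nonneg]
    have := CStarAlgebra.star_mul_le_algebraMap_norm_sq (a := b)
    rwa [Algebra.algebraMap_eq_smul_one] at this
  obtain ⟨d, hd⟩ := CStarAlgebra.nonneg_iff_eq_star_mul_self.mp h
  have key : ⟪preMul T d f, preMul T d f⟫_ℂ
      = (‖b‖ ^ 2 : ℝ) * ⟪f, f⟫_ℂ - ⟪preMul T b f, preMul T b f⟫_ℂ := by
    rw [inner_preMul, inner_preMul, inner_def, ← hd]
    simp only [Finsupp.sum, Finset.mul_sum, ← Finset.sum_sub_distrib]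
    refine Finset.sum_congr rfl fun x _ => Finset.sum_congr rfl fun y _ => ?_
    have : T (star y.1 * ((‖b‖ ^ 2 : ℝ) • (1 : B) - star b * b) * x.1)
        = ((‖b‖ ^ 2 : ℝ) : ℂ) • T (star y.1 * x.1) - T (star y.1 * (star b * b) * x.1) := by
      rw [← map_smul, ← map_sub, mul_sub, sub_mul]
      congr 2
      simp only [mul_smul_comm, smul_mul_assoc, mul_one]
      rfl
    rw [this]
    have hs (A A' : B) (r : ℝ) (v w : G) : ⟪(((r : ℂ) • A - A' : B) : G →L[ℂ] G) v, w⟫_ℂ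
        = r * ⟪(A : G →L[ℂ] G) v, w⟫_ℂ - ⟪(A' : G →L[ℂ] G) v, w⟫_ℂ := by
      change ⟪(r : ℂ) • (A : G →L[ℂ] G) v - (A' : G →L[ℂ] G) v, w⟫_ℂ = _
      rw [inner_sub_left, inner_smul_left, Complex.conj_ofReal]
    rw [hs]
    ring
  have h2 := congrArg Complex.re key
  rw [Complex.sub_re, Complex.re_ofReal_mul] at h2
  have e (u : RKHS.H₀ (kernel T)) : (⟪u, u⟫_ℂ).re = ‖u‖ ^ 2 := inner_self_eq_norm_sq (𝕜 := ℂ) u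
  rw [e, e, e] at h2
  refine le_of_sq_le_sq ?_ (by positivity)
  nlinarith [sq_nonneg ‖preMul T d f‖]

/-- The Stinespring representation of `B` on `H`: the bounded operator with
`b (a ⊙ g) = (b a) ⊙ g`. -/
noncomputable def leftRep (b : B) : Space T →L[ℂ] Space T :=
  ((preMul T b).mkContinuous ‖b‖ (norm_preMul_le T b)).completion

theorem leftRep_kerFun (b a : B) :
    leftRep T b ∘L RKHS.kerFun (Space T) a = RKHS.kerFun (Space T) (b * a) := by
  have e (a : B) (g : G) : RKHS.kerFun (Space T) a g
      = ((Finsupp.single (a, g) 1 : RKHS.H₀ (kernel T)) : Space T) :=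
    DFunLike.congr_fun (ContinuousLinearMap.adjoint_adjoint _) g
  ext1 g
  rw [ContinuousLinearMap.comp_apply, e, e]
  refine (UniformSpace.Completion.map_coe
    ((preMul T b).mkContinuous ‖b‖ (norm_preMul_le T b)).uniformContinuous _).trans ?_
  congr 1
  exact Finsupp.mapDomain_single

theorem ext_kerFun {S S' : Space T →L[ℂ] Space T}
    (h : ∀ a, S ∘L RKHS.kerFun (Space T) a = S' ∘L RKHS.kerFun (Space T) a) : S = S' := by
  refine ContinuousLinearMap.ext_on (s := {RKHS.kerFun (Space T) a g | (a) (g)})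
    (Submodule.dense_iff_topologicalClosure_eq_top.mpr (RKHS.kerFun_dense (Space T))) ?_
  rintro _ ⟨a, g, rfl⟩
  exact DFunLike.congr_fun (h a) g

theorem leftRep_one : leftRep T 1 = ContinuousLinearMap.id ℂ (Space T) :=
  ext_kerFun T fun a => by rw [leftRep_kerFun, one_mul, ContinuousLinearMap.id_comp]

theorem leftRep_mul (b c : B) : leftRep T (b * c) = leftRep T b ∘L leftRep T c :=
  ext_kerFun T fun a => by
    rw [leftRep_kerFun, mul_assoc, ContinuousLinearMap.comp_assoc, leftRep_kerFun, leftRep_kerFun]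

/-- The operator `g ↦ 1 ⊙ g` from `G` to `H` that represents the cyclic vector `ξ = 1 ⊗ 1`. -/
noncomputable def cyclicOp : G →L[ℂ] Space T := RKHS.kerFun (Space T) 1

/-- The GNS-correspondence `E ⊆ B(G, H)` of `T`: the strong closure of the linear span of all
`a ξ b` with `a, b ∈ B`. -/
noncomputable def gnsModule : Submodule ℂ (G →L[ℂ] Space T) :=
  strongClosure (Submodule.span ℂ
    {x | ∃ a b : B, x = leftRep T a ∘L cyclicOp T ∘L (b : G →L[ℂ] G)})

theorem gnsModule_comp_mem (a b : B) {x : G →L[ℂ] Space T} (hx : x ∈ gnsModule T) :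
    leftRep T a ∘L x ∘L (b : G →L[ℂ] G) ∈ gnsModule T := by
  refine strongClosure_comp_mem _ _ (fun y hy => ?_) hx
  induction hy using Submodule.span_induction with
  | mem y hy =>
    obtain ⟨a', b', rfl⟩ := hy
    refine Submodule.subset_span ⟨a * a', b' * b, ?_⟩
    rw [leftRep_mul]
    rfl
  | zero => simp
  | add y z _ _ hy hz =>
    rw [ContinuousLinearMap.add_comp, ContinuousLinearMap.comp_add]
    exact add_mem hy hz
  | smul r y _ hy =>
    rw [ContinuousLinearMap.smul_comp, ContinuousLinearMap.comp_smul]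
    exact Submodule.smul_mem _ r hy

/-- The left action `x ↦ b x` of `b ∈ B` on `E`. -/
noncomputable def leftMul (b : B) (x : gnsModule T) : gnsModule T :=
  ⟨leftRep T b ∘L x, by simpa using! gnsModule_comp_mem T b 1 x.2⟩

/-- The right action `x ↦ x b` of `b ∈ B` on `E`. -/
noncomputable def rightMul (x : gnsModule T) (b : B) : gnsModule T :=
  ⟨x ∘L b, by simpa [leftRep_one] using! gnsModule_comp_mem T 1 b x.2⟩

/-- The cyclic vector `ξ ∈ E`. -/
noncomputable def cyclicVector : gnsModule T :=
  ⟨cyclicOp T, subset_strongClosure (Submodule.subset_span ⟨1, 1, by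
    rw [leftRep_one]
    rfl⟩)⟩

/-- `T b = ⟪ξ, b ξ⟫`. -/
theorem inner_cyclicVector (b : B) :
    (cyclicVector T : G →L[ℂ] Space T).adjoint ∘L (leftMul T b (cyclicVector T))
      = (T b : G →L[ℂ] G) := by
  change (cyclicOp T).adjoint ∘L leftRep T b ∘L cyclicOp T = (T b : G →L[ℂ] G)
  rw [cyclicOp, leftRep_kerFun, ← RKHS.kernel_apply, RKHS.OfKernel.kernel_ofKernel, kernel_apply]
  simp

end CPMap

/-!
If `α` exists, then for `c, d ∈ C` both `T(c) d = ⟪ξ, c ξ d⟫` and `d T(c) = ⟪ξ d⋆, c ξ⟫` can be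
computed from `ξ d = d ξ - α(d) ξ`. Since `α` preserves adjoints and `α(d)` commutes with the left
action of `c`, the results agree (`CPMap.map_mem_of_exists`). So `T(c)` lies in `C' ∩ B`, which is
`C` by maximality (`VonNeumannAlgebra.IsMaximalCommutative.mem_of_commute`).

Conversely, let `T(C) ⊆ C` and let `K ⊆ H` be the closed span of the vectors `d ⊙ g` with `d ∈ C`.
Since `T(d⋆ e)` commutes with `c ∈ C` for `d, e ∈ C`, the map `d ⊙ g ↦ d ⊙ c g` is well defined and
bounded on `K` (`exists_comp_eq`). Let `D c` be `d ⊙ g ↦ c d ⊙ g - d ⊙ c g` on `K` and `0` on its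
orthogonal complement. The operators `D c` form a `⋆`-map and commute with the left action of `C`
since this can be checked on `K`, which reduces the operators involved; evaluating at `d = 1` gives
`D(c) ξ = c ξ - ξ c`. So `α(c) x = D(c) x` works, provided that `D(c)` maps `E` into itself. For
this, `E` is identified with the space of all operators `G → H` that intertwine the two actions of
the commutant `B'` (`CPMap.mem_gnsModule_iff`), by means of a bicommutant argument on finite
amplifications (`mem_strongClosure_of_intertwines`); and `D(c)` commutes with the action of `B'`.
-/

/-! ### Finite amplifications and strong closures -/

section Amplification

variable {G H : Type*} [NormedAddCommGroup G] [InnerProductSpace ℂ G]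
  [NormedAddCommGroup H] [InnerProductSpace ℂ H] {n : Type*} [Fintype n]

/-- The amplification `(v i)ᵢ ↦ (y (v i))ᵢ` of `y` to the `ℓ²`-direct sums of copies of `G` and `H`
indexed by the finite type `n`. -/
noncomputable def amplify (n : Type*) [Fintype n] (y : G →L[ℂ] H) :
    PiLp 2 (fun _ : n => G) →L[ℂ] PiLp 2 (fun _ : n => H) :=
  (PiLp.continuousLinearEquiv 2 ℂ (fun _ : n => H)).symm.toContinuousLinearMap ∘L
    ContinuousLinearMap.pi fun i => y ∘L PiLp.proj 2 (fun _ : n => G) i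

@[simp]
theorem amplify_apply (y : G →L[ℂ] H) (v : PiLp 2 (fun _ : n => G)) (i : n) :
    amplify n y v i = y (v i) := rfl

theorem amplify_inner [CompleteSpace G] [CompleteSpace H] (y z : G →L[ℂ] H)
    (v w : PiLp 2 (fun _ : n => G)) :
    ⟪amplify n y v, amplify n z w⟫_ℂ = ⟪v, amplify n (y.adjoint ∘L z) w⟫_ℂ := by
  simp [PiLp.inner_apply, ContinuousLinearMap.adjoint_inner_right]

/-- The subspace of all `(y (g i))ᵢ`, where `y` runs through the linear space `S`. -/
def amplifyOrbit (S : Submodule ℂ (G →L[ℂ] H)) (g : PiLp 2 (fun _ : n => G)) :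
    Submodule ℂ (PiLp 2 (fun _ : n => H)) where
  carrier := {v | ∃ y ∈ S, amplify n y g = v}
  add_mem' := by
    rintro _ _ ⟨y, hy, rfl⟩ ⟨z, hz, rfl⟩
    exact ⟨y + z, add_mem hy hz, by ext; simp⟩
  zero_mem' := ⟨0, zero_mem _, by ext; simp⟩
  smul_mem' := by
    rintro r _ ⟨y, hy, rfl⟩
    exact ⟨r • y, S.smul_mem r hy, by ext; simp⟩

/-- The entry `P i j` of an operator `P` on `Gⁿ`, viewed as an `n × n` matrix of operators on `G`. -/
noncomputable def matrixEntry [DecidableEq n]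
    (P : PiLp 2 (fun _ : n => G) →L[ℂ] PiLp 2 (fun _ : n => G)) (i j : n) :
    G →L[ℂ] G :=
  PiLp.proj 2 (fun _ : n => G) i ∘L P ∘L
    (PiLp.continuousLinearEquiv 2 ℂ (fun _ : n => G)).symm.toContinuousLinearMap ∘L
    ContinuousLinearMap.single ℂ (fun _ : n => G) j

theorem apply_eq_sum_matrixEntry [DecidableEq n]
    (P : PiLp 2 (fun _ : n => G) →L[ℂ] PiLp 2 (fun _ : n => G)) (i : n)
    (v : PiLp 2 (fun _ : n => G)) :
    P v i = ∑ j, matrixEntry P i j (v j) := by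
  have hv : v = ∑ j, PiLp.single 2 j (v j) := by
    ext k
    simp [Pi.single_apply]
  conv_lhs => rw [hv, map_sum]
  simp only [WithLp.ofLp_sum, Finset.sum_apply]
  rfl

theorem amplify_single [DecidableEq n] (y : G →L[ℂ] H) (j : n) (g : G) :
    amplify n y (PiLp.single 2 j g) = PiLp.single 2 j (y g) := by
  ext k
  by_cases h : k = j
  · subst h; simp
  · simp [h]

variable [CompleteSpace G] [CompleteSpace H]

/-- If `S` is a right `N`-module with `S⋆ S ⊆ N`, then `y ∈ S` maps the closure of `N g` into the
closure of `S g` and the orthogonal complement of the former into that of the latter. Hence the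
amplification of `y` intertwines the two projections. -/
theorem amplify_starProjection (N : Submodule ℂ (G →L[ℂ] G)) (S : Submodule ℂ (G →L[ℂ] H))
    (hr : ∀ y ∈ S, ∀ b ∈ N, y ∘L b ∈ S) (hi : ∀ y ∈ S, ∀ z ∈ S, y.adjoint ∘L z ∈ N)
    (g v : PiLp 2 (fun _ : n => G)) {y : G →L[ℂ] H} (hy : y ∈ S) :
    amplify n y ((amplifyOrbit N g).topologicalClosure.starProjection v) =
      (amplifyOrbit S g).topologicalClosure.starProjection (amplify n y v) := by
  refine (Submodule.eq_starProjection_of_mem_of_inner_eq_zero ?_ ?_).symm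
  · have h1 : Set.MapsTo (amplify n y) (amplifyOrbit N g) (amplifyOrbit S g) := by
      rintro _ ⟨b, hb, rfl⟩
      exact ⟨y ∘L b, hr y hy b hb, by ext; simp⟩
    exact h1.closure (amplify n y).continuous
      ((amplifyOrbit N g).topologicalClosure.starProjection_apply_mem v)
  · intro w hw
    have h2 : ∀ w ∈ amplifyOrbit S g, ⟪amplify n y v -
        amplify n y ((amplifyOrbit N g).topologicalClosure.starProjection v), w⟫_ℂ = 0 := by
      rintro _ ⟨z, hz, rfl⟩
      rw [← map_sub, amplify_inner, ← inner_conj_symm]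
      rw [← inner_conj_symm, Submodule.starProjection_inner_eq_zero, map_zero, map_zero]
      exact Submodule.le_topologicalClosure _ ⟨_, hi y hy z hz, rfl⟩
    have hc : IsClosed {w | ⟪amplify n y v -
        amplify n y ((amplifyOrbit N g).topologicalClosure.starProjection v), w⟫_ℂ = 0} :=
      isClosed_eq (by fun_prop) continuous_const
    exact closure_minimal h2 hc hw

/-- A bicommutant theorem for right modules over a von Neumann algebra: `S` is strongly dense in the
space of all `x` that satisfy `h x = x b` whenever `b ∈ M'` and `h` satisfies `h y = y b` for all
`y ∈ S`. As in the bicommutant theorem for algebras, the projections onto the closures of `M g` and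
`S g` have entries that form such pairs `(b, h)`, so that `x g` stays in the closure of `S g`. -/
theorem mem_strongClosure_of_intertwines (M : VonNeumannAlgebra G)
    (S : Submodule ℂ (G →L[ℂ] H))
    (hr : ∀ y ∈ S, ∀ b ∈ M, y ∘L b ∈ S) (hi : ∀ y ∈ S, ∀ z ∈ S, y.adjoint ∘L z ∈ M)
    {x : G →L[ℂ] H}
    (hx : ∀ b ∈ M.commutant, ∀ h : H →L[ℂ] H, (∀ y ∈ S, h ∘L y = y ∘L b) → h ∘L x = x ∘L b) :
    x ∈ strongClosure S := by
  classical
  let N : Submodule ℂ (G →L[ℂ] G) := M.toStarSubalgebra.toSubalgebra.toSubmodule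
  have hN : ∀ b ∈ N, b.adjoint ∈ N := fun b hb => star_mem (S := VonNeumannAlgebra G) (s := M) hb
  have key : ∀ (s : Finset G), amplify s x (WithLp.toLp 2 fun i => i.1) ∈
      (amplifyOrbit S (WithLp.toLp 2 fun i : s => i.1)).topologicalClosure := by
    intro s
    -- the vector in `Gˢ` whose coordinates are the elements of `s`
    set g : PiLp 2 (fun _ : s => G) := WithLp.toLp 2 fun i => i.1
    set P := (amplifyOrbit N g).topologicalClosure.starProjection
    set Q := (amplifyOrbit S g).topologicalClosure.starProjection
    have hP : ∀ i j, matrixEntry P i j ∈ M.commutant := by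
      intro i j
      rw [VonNeumannAlgebra.mem_commutant_iff]
      intro b hb
      ext v
      have h := amplify_starProjection N N (fun y hy b hb => mul_mem (s := M) hy hb)
        (fun y hy z hz => mul_mem (s := M) (hN y hy) hz) g (PiLp.single 2 j v) hb
      have h := congrArg (fun w : PiLp 2 (fun _ : s => G) => w i) h
      rw [amplify_single] at h
      exact h
    have hQ : ∀ i j, ∀ y ∈ S, matrixEntry Q i j ∘L y = y ∘L matrixEntry P i j := by
      intro i j y hy
      ext v
      have h := amplify_starProjection N S hr hi g (PiLp.single 2 j v) hy
      have h := congrArg (fun w : PiLp 2 (fun _ : s => H) => w i) h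
      rw [amplify_single] at h
      exact h.symm
    have hg : P g = g := by
      rw [Submodule.starProjection_eq_self_iff]
      exact Submodule.le_topologicalClosure _ ⟨1, one_mem M, by ext; simp⟩
    have hxg : amplify s x g = Q (amplify s x g) := by
      conv_lhs => rw [← hg]
      ext i
      rw [apply_eq_sum_matrixEntry, amplify_apply, apply_eq_sum_matrixEntry, map_sum]
      refine Finset.sum_congr rfl fun j _ => ?_
      exact (DFunLike.congr_fun (hx _ (hP i j) _ (hQ i j)) (g j)).symm
    rw [hxg]
    exact Submodule.starProjection_apply_mem _ _
  rw [mem_strongClosure, mem_closure_iff]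
  intro o ho hxo
  obtain ⟨s, u, hu, hs⟩ := isOpen_pi_iff.mp ho _ hxo
  have hopen : IsOpen (⋂ i : s, {w : PiLp 2 (fun _ : s => H) | w i ∈ u i}) :=
    isOpen_iInter_of_finite fun i =>
      (hu i i.2).1.preimage (PiLp.continuous_apply 2 (fun _ : s => H) i)
  obtain ⟨_, hw, y, hy, rfl⟩ := mem_closure_iff.mp (key s) _ hopen
    (Set.mem_iInter.mpr fun i => (hu i i.2).2)
  exact ⟨y, hs fun i hi => Set.mem_iInter.mp hw ⟨i, hi⟩, y, hy, rfl⟩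

end Amplification

/-! ### Right multiplication on the space spanned by a family of operators -/

section Extension

variable {G H : Type*} [NormedAddCommGroup G] [InnerProductSpace ℂ G] [CompleteSpace G]
  [NormedAddCommGroup H] [InnerProductSpace ℂ H] [CompleteSpace H] {ι : Type*}

/-- Bounded operators agree if they agree on the vectors `k i g` and on those orthogonal to all of
them. The latter are described as the common kernel of the adjoints `(k i)⋆`. -/
theorem ext_of_family {F : Type*} [NormedAddCommGroup F] [NormedSpace ℂ F]
    (k : ι → G →L[ℂ] H) {S S' : H →L[ℂ] F} (h : ∀ i, S ∘L k i = S' ∘L k i)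
    (h' : ∀ y, (∀ i, (k i).adjoint y = 0) → S y = S' y) : S = S' := by
  let L : Submodule ℂ H := LinearMap.eqLocus S.toLinearMap S'.toLinearMap
  have hL : IsClosed (L : Set H) := isClosed_eq S.continuous S'.continuous
  have : CompleteSpace L := hL.completeSpace_coe
  have hbot : Lᗮ = ⊥ := by
    refine (Submodule.eq_bot_iff _).mpr fun y hy => ?_
    have h0 : ∀ i, (k i).adjoint y = 0 := fun i => by
      refine ext_inner_left ℂ fun g => ?_
      rw [ContinuousLinearMap.adjoint_inner_right, inner_zero_right]
      exact hy _ (DFunLike.congr_fun (h i) g)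
    have hyL : y ∈ L := h' y h0
    exact inner_self_eq_zero.mp (hy y hyL)
  have htop : L = ⊤ := Submodule.orthogonal_eq_bot_iff.mp hbot
  ext v
  exact (htop ▸ Submodule.mem_top : v ∈ L)

theorem inner_finsuppSum (k : ι → G →L[ℂ] H) {w : G →L[ℂ] G}
    (hw : ∀ i j, Commute ((k i).adjoint ∘L k j) w) (f : ι →₀ G) :
    ⟪f.sum fun i g => k i (w g), f.sum fun i g => k i (w g)⟫_ℂ =
      f.sum fun i g => f.sum fun j g' => ⟪g, (star w * w) ((k i).adjoint (k j g'))⟫_ℂ := by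
  simp only [Finsupp.sum_inner, Finsupp.inner_sum]
  rw [Finsupp.sum_comm]
  refine Finsupp.sum_congr fun i _ => Finsupp.sum_congr fun j _ => ?_
  have h : (k i).adjoint (k j (w (f j))) = w ((k i).adjoint (k j (f j))) :=
    DFunLike.congr_fun (hw i j).eq (f j)
  rw [← ContinuousLinearMap.adjoint_inner_right, h, ← ContinuousLinearMap.adjoint_inner_right]
  rfl

/-- With `d⋆ d = ‖u‖² - u⋆ u`, the squared norms of `∑ k i (u g)` and `∑ k i (d g)` add up to
`‖u‖²` times that of `∑ k i g`. -/
theorem norm_finsuppSum_le (k : ι → G →L[ℂ] H) (u : G →L[ℂ] G)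
    (hu : ∀ i j, Commute ((k i).adjoint ∘L k j) u)
    (hu' : ∀ i j, Commute ((k i).adjoint ∘L k j) (star u)) (f : ι →₀ G) :
    ‖f.sum fun i g => k i (u g)‖ ≤ ‖u‖ * ‖f.sum fun i g => k i g‖ := by
  have h0 : 0 ≤ algebraMap ℝ (G →L[ℂ] G) (‖u‖ ^ 2) - star u * u :=
    sub_nonneg.mpr CStarAlgebra.star_mul_le_algebraMap_norm_sq
  set p := algebraMap ℝ (G →L[ℂ] G) (‖u‖ ^ 2) - star u * u with hp
  have hd : ∀ i j, Commute ((k i).adjoint ∘L k j) (CFC.sqrt p) := fun i j => by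
    have h1 : Commute ((k i).adjoint ∘L k j) p :=
      Commute.sub_right (Algebra.commutes (‖u‖ ^ 2) ((k i).adjoint ∘L k j)).symm
        ((hu' i j).mul_right (hu i j))
    exact (h1.symm.cfcₙ_nnreal NNReal.sqrt).symm
  have hdd : star (CFC.sqrt p) * CFC.sqrt p = p := by
    rw [(CFC.sqrt_nonneg p).isSelfAdjoint.star_eq, CFC.sqrt_mul_sqrt_self p h0]
  have h1 := inner_finsuppSum k (w := 1) (fun i j => Commute.one_right _) f
  have key : ⟪f.sum fun i g => k i (CFC.sqrt p g), f.sum fun i g => k i (CFC.sqrt p g)⟫_ℂ =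
      ((‖u‖ ^ 2 : ℝ) : ℂ) * ⟪f.sum fun i g => k i g, f.sum fun i g => k i g⟫_ℂ -
        ⟪f.sum fun i g => k i (u g), f.sum fun i g => k i (u g)⟫_ℂ := by
    simp only [one_apply_eq_self] at h1
    rw [h1, inner_finsuppSum k hd, inner_finsuppSum k hu, hdd]
    simp only [Finsupp.sum, Finset.mul_sum, ← Finset.sum_sub_distrib]
    refine Finset.sum_congr rfl fun i _ => Finset.sum_congr rfl fun j _ => ?_
    rw [hp, sub_apply, inner_sub_right, Algebra.algebraMap_eq_smul_one,
      ← Complex.coe_smul, smul_apply, inner_smul_right]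
    simp
  have h2 := congrArg Complex.re key
  rw [Complex.sub_re, Complex.re_ofReal_mul] at h2
  have e (v : H) : (⟪v, v⟫_ℂ).re = ‖v‖ ^ 2 := inner_self_eq_norm_sq (𝕜 := ℂ) v
  rw [e, e, e] at h2
  refine le_of_sq_le_sq ?_ (by positivity)
  nlinarith [sq_nonneg ‖f.sum fun i g => k i (CFC.sqrt p g)‖]

/-- If `u` and `u⋆` commute with all `(k i)⋆ (k j)`, then `k i g ↦ k i (u g)` extends to a bounded
operator that vanishes on the orthogonal complement of the vectors `k i g`. For `u = 1` this is the
projection onto their closed span. -/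
theorem exists_comp_eq (k : ι → G →L[ℂ] H) (u : G →L[ℂ] G)
    (hu : ∀ i j, Commute ((k i).adjoint ∘L k j) u)
    (hu' : ∀ i j, Commute ((k i).adjoint ∘L k j) (star u)) :
    ∃ R : H →L[ℂ] H, (∀ i, R ∘L k i = k i ∘L u) ∧
      ∀ y, (∀ i, (k i).adjoint y = 0) → R y = 0 := by
  classical
  let Φ : (ι →₀ G) →ₗ[ℂ] H := Finsupp.lsum ℂ fun i => (k i).toLinearMap
  let Ψ : (ι →₀ G) →ₗ[ℂ] H := Finsupp.lsum ℂ fun i => (k i ∘L u).toLinearMap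
  let K : Submodule ℂ H := (LinearMap.range Φ).topologicalClosure
  let e : (ι →₀ G) →ₗ[ℂ] K := Φ.codRestrict K fun f =>
    Submodule.le_topologicalClosure _ ⟨f, rfl⟩
  have he : DenseRange e := by
    intro v
    rw [Topology.IsInducing.subtypeVal.closure_eq_preimage_closure_image, ← Set.range_comp]
    exact v.2
  have hb : ∃ c, ∀ f, ‖Ψ f‖ ≤ c * ‖e f‖ := ⟨‖u‖, norm_finsuppSum_le k u hu hu'⟩
  have hk : ∀ i g, k i g ∈ K := fun i g =>
    Submodule.le_topologicalClosure _ ⟨Finsupp.single i g, by simp [Φ]⟩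
  refine ⟨Ψ.extendOfNorm e ∘L K.orthogonalProjectionOnto, fun i => ?_, fun y hy => ?_⟩
  · ext g
    have h1 : K.orthogonalProjectionOnto (k i g) = e (Finsupp.single i g) := by
      rw [K.orthogonalProjectionOnto_mem_subspace_eq_self ⟨k i g, hk i g⟩]
      ext
      simp [e, Φ]
    rw [ContinuousLinearMap.comp_apply, ContinuousLinearMap.comp_apply, h1,
      LinearMap.extendOfNorm_eq he hb]
    simp [Ψ]
  · rw [ContinuousLinearMap.comp_apply, K.orthogonalProjectionOnto_apply_of_mem_orthogonal,
      map_zero]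
    rw [Submodule.orthogonal_closure]
    rintro _ ⟨f, rfl⟩
    simp [Φ, Finsupp.sum_inner, ← ContinuousLinearMap.adjoint_inner_right, hy]

end Extension

/-! ### Maximal commutative subalgebras -/

namespace VonNeumannAlgebra

variable {G : Type*} [NormedAddCommGroup G] [InnerProductSpace ℂ G] [CompleteSpace G]

/-- The von Neumann algebra generated by `C` and `h` is commutative and contained in `B`. -/
theorem IsMaximalCommutative.mem_of_isSelfAdjoint {C B : VonNeumannAlgebra G}
    (hC : C.IsMaximalCommutative B) {h : G →L[ℂ] G} (hB : h ∈ B) (hsa : IsSelfAdjoint h)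
    (hcomm : ∀ c ∈ C, c * h = h * c) : h ∈ C := by
  let N : VonNeumannAlgebra G :=
    { toStarSubalgebra := StarSubalgebra.centralizer ℂ ((C : Set (G →L[ℂ] G)) ∪ {h})
      centralizer_centralizer' := Set.centralizer_centralizer_centralizer _ }
  have hstar : ∀ x ∈ (C : Set (G →L[ℂ] G)) ∪ {h}, star x ∈ (C : Set (G →L[ℂ] G)) ∪ {h} := by
    rintro x (hx | rfl)
    · exact Or.inl (star_mem hx)
    · exact Or.inr hsa
  have hN : ∀ z, z ∈ N ↔ ∀ x ∈ (C : Set (G →L[ℂ] G)) ∪ {h}, x * z = z * x := by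
    intro z
    refine StarSubalgebra.mem_centralizer_iff (R := ℂ).trans
      ⟨fun hz x hx => (hz x hx).1, fun hz x hx => ⟨hz x hx, hz _ (hstar x hx)⟩⟩
  have hle : ∀ x ∈ (C : Set (G →L[ℂ] G)) ∪ {h}, x ∈ N.commutant := fun x hx =>
    mem_commutant_iff.mpr fun z hz => ((hN z).mp hz x hx).symm
  have hsub : ∀ x ∈ (C : Set (G →L[ℂ] G)) ∪ {h}, x ∈ N := by
    intro x hx
    refine (hN x).mpr fun y hy => ?_
    rcases hx with hx | rfl <;> rcases hy with hy | rfl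
    · exact hC.prop.2 y hy x hx
    · exact (hcomm x hx).symm
    · exact hcomm y hy
    · rfl
  have hD : N.commutant ≤ B ∧ ∀ x ∈ N.commutant, ∀ y ∈ N.commutant, x * y = y * x := by
    refine ⟨fun d hd => ?_, fun x hx y hy => ?_⟩
    · rw [← B.commutant_commutant, mem_commutant_iff]
      intro z hz
      refine mem_commutant_iff.mp hd z ((hN z).mpr fun x hx => ?_)
      refine mem_commutant_iff.mp hz x ?_
      rcases hx with hx | rfl
      exacts [hC.prop.1 hx, hB]
    · refine mem_commutant_iff.mp hy x ((hN x).mpr fun z hz => ?_)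
      exact mem_commutant_iff.mp hx z (hsub z hz)
  exact hC.le_of_ge hD (fun c hc => hle c (Or.inl hc)) (hle h (Or.inr rfl))

/-- A maximal commutative von Neumann subalgebra contains its relative commutant `C' ∩ B`. -/
theorem IsMaximalCommutative.mem_of_commute {C B : VonNeumannAlgebra G}
    (hC : C.IsMaximalCommutative B) {x : G →L[ℂ] G} (hB : x ∈ B)
    (hcomm : ∀ c ∈ C, c * x = x * c) : x ∈ C := by
  have hcomm' : ∀ c ∈ C, c * star x = star x * c := fun c hc => by
    simpa using (congrArg star (hcomm (star c) (star_mem hc))).symm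
  rw [← realPart_add_I_smul_imaginaryPart x]
  refine add_mem ?_ (SMulMemClass.smul_mem _ ?_)
  · refine hC.mem_of_isSelfAdjoint ?_ (realPart x).2 fun c hc => ?_
    · rw [realPart_apply_coe, ← Complex.coe_smul]
      exact SMulMemClass.smul_mem _ (add_mem hB (star_mem hB))
    · simp only [realPart_apply_coe, mul_smul_comm, smul_mul_assoc, mul_add, add_mul, hcomm c hc,
        hcomm' c hc]
  · refine hC.mem_of_isSelfAdjoint ?_ (imaginaryPart x).2 fun c hc => ?_
    · rw [imaginaryPart_apply_coe, ← Complex.coe_smul]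
      exact SMulMemClass.smul_mem _ (SMulMemClass.smul_mem _ (sub_mem hB (star_mem hB)))
    · simp only [imaginaryPart_apply_coe, mul_smul_comm, smul_mul_assoc, mul_sub, sub_mul,
        hcomm c hc, hcomm' c hc]

end VonNeumannAlgebra

/-! ### The GNS-module as a space of intertwiners -/

namespace CPMap

variable {G : Type*} [NormedAddCommGroup G] [InnerProductSpace ℂ G] [CompleteSpace G]
variable {B : VonNeumannAlgebra G} (T : B →CP B)

theorem adjoint_kerFun_comp_kerFun (a b : B) :
    (RKHS.kerFun (Space T) a).adjoint ∘L RKHS.kerFun (Space T) b =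
      (T (star a * b) : G →L[ℂ] G) := by
  rw [← RKHS.kernel_apply, RKHS.OfKernel.kernel_ofKernel, kernel_apply]

theorem leftRep_cyclicOp (a : B) : leftRep T a ∘L cyclicOp T = RKHS.kerFun (Space T) a := by
  rw [cyclicOp, leftRep_kerFun, mul_one]

theorem ext_kerFun_left {F : Type*} [NormedAddCommGroup F] [NormedSpace ℂ F]
    {S S' : F →L[ℂ] Space T}
    (h : ∀ a, (RKHS.kerFun (Space T) a).adjoint ∘L S = (RKHS.kerFun (Space T) a).adjoint ∘L S') :
    S = S' := by
  ext1 v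
  refine RKHS.ext fun a => ?_
  rw [← RKHS.adjoint_kerFun, ← RKHS.adjoint_kerFun]
  exact DFunLike.congr_fun (h a) v

theorem adjoint_leftRep (b : B) : (leftRep T b).adjoint = leftRep T (star b) :=
  ext_kerFun T fun a => ext_kerFun_left T fun a' => by
    rw [leftRep_kerFun, adjoint_kerFun_comp_kerFun, ← ContinuousLinearMap.comp_assoc,
      ← ContinuousLinearMap.adjoint_comp, leftRep_kerFun, adjoint_kerFun_comp_kerFun, star_mul,
      mul_assoc]

theorem adjoint_kerFun_comp_leftRep (a b : B) :
    (RKHS.kerFun (Space T) a).adjoint ∘L leftRep T b =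
      (RKHS.kerFun (Space T) (star b * a)).adjoint := by
  rw [← leftRep_kerFun, ContinuousLinearMap.adjoint_comp, adjoint_leftRep, star_star]

/-- An operator `h` that acts as `a ⊙ g ↦ a ⊙ b g` for some `b` in the commutant of `B` satisfies the
adjoint relation as well. -/
theorem adjoint_kerFun_comp {b : G →L[ℂ] G} (hb : b ∈ B.commutant) {h : Space T →L[ℂ] Space T}
    (hh : ∀ a, h ∘L RKHS.kerFun (Space T) a = RKHS.kerFun (Space T) a ∘L b) (a : B) :
    (RKHS.kerFun (Space T) a).adjoint ∘L h = b ∘L (RKHS.kerFun (Space T) a).adjoint := by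
  have hadj : h.adjoint ∘L RKHS.kerFun (Space T) a = RKHS.kerFun (Space T) a ∘L b.adjoint := by
    refine ext_kerFun_left T fun a' => ?_
    rw [← ContinuousLinearMap.comp_assoc, ← ContinuousLinearMap.adjoint_comp, hh,
      ContinuousLinearMap.adjoint_comp, ContinuousLinearMap.comp_assoc,
      ← ContinuousLinearMap.comp_assoc (RKHS.kerFun (Space T) a').adjoint,
      adjoint_kerFun_comp_kerFun]
    exact (VonNeumannAlgebra.mem_commutant_iff.mp (star_mem hb) _ (T (star a' * a)).2).symm
  have := congrArg ContinuousLinearMap.adjoint hadj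
  simpa [ContinuousLinearMap.adjoint_comp] using this

/-- The linear span of all `a ξ b` with `a, b ∈ B`, whose strong closure is the GNS-module. -/
noncomputable def cyclicSpan : Submodule ℂ (G →L[ℂ] Space T) :=
  Submodule.span ℂ {x | ∃ a b : B, x = leftRep T a ∘L cyclicOp T ∘L (b : G →L[ℂ] G)}

theorem kerFun_comp_mem_cyclicSpan (a : B) {b : G →L[ℂ] G} (hb : b ∈ B) :
    RKHS.kerFun (Space T) a ∘L b ∈ cyclicSpan T :=
  Submodule.subset_span ⟨a, ⟨b, hb⟩, by rw [← leftRep_cyclicOp, ContinuousLinearMap.comp_assoc]⟩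

theorem kerFun_mem_cyclicSpan (a : B) : RKHS.kerFun (Space T) a ∈ cyclicSpan T := by
  simpa using! kerFun_comp_mem_cyclicSpan T a (one_mem B)

theorem cyclicSpan_induction {p : (G →L[ℂ] Space T) → Prop}
    (hgen : ∀ a b : B, p (RKHS.kerFun (Space T) a ∘L (b : G →L[ℂ] G)))
    (hzero : p 0) (hadd : ∀ y z, p y → p z → p (y + z)) (hsmul : ∀ (r : ℂ) y, p y → p (r • y))
    {y : G →L[ℂ] Space T} (hy : y ∈ cyclicSpan T) : p y := by
  induction hy using Submodule.span_induction with
  | mem y hy =>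
    obtain ⟨a, b, rfl⟩ := hy
    rw [← ContinuousLinearMap.comp_assoc, leftRep_cyclicOp]
    exact hgen a b
  | zero => exact hzero
  | add y z _ _ hy hz => exact hadd y z hy hz
  | smul r y _ hy => exact hsmul r y hy

theorem adjoint_comp_mem {y z : G →L[ℂ] Space T} (hy : y ∈ cyclicSpan T)
    (hz : z ∈ cyclicSpan T) : y.adjoint ∘L z ∈ B := by
  refine cyclicSpan_induction T (p := fun y => y.adjoint ∘L z ∈ B)
    (fun a b => ?_) ?_ (fun y y' h h' => ?_) (fun r y h => ?_) hy
  · refine cyclicSpan_induction T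
      (p := fun z => (RKHS.kerFun (Space T) a ∘L (b : G →L[ℂ] G)).adjoint ∘L z ∈ B)
      (fun a' b' => ?_) ?_ (fun z z' h h' => ?_) (fun r z h => ?_) hz
    · rw [ContinuousLinearMap.adjoint_comp, ContinuousLinearMap.comp_assoc,
        ← ContinuousLinearMap.comp_assoc (RKHS.kerFun (Space T) a).adjoint,
        adjoint_kerFun_comp_kerFun]
      exact mul_mem (star_mem b.2) (mul_mem (T (star a * a')).2 b'.2)
    · rw [ContinuousLinearMap.comp_zero]
      exact zero_mem B
    · rw [ContinuousLinearMap.comp_add]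
      exact add_mem h h'
    · rw [ContinuousLinearMap.comp_smul]
      exact SMulMemClass.smul_mem r h
  · rw [map_zero, ContinuousLinearMap.zero_comp]
    exact zero_mem B
  · rw [map_add, ContinuousLinearMap.add_comp]
    exact add_mem h h'
  · rw [map_smulₛₗ, ContinuousLinearMap.smul_comp]
    exact SMulMemClass.smul_mem _ h

/-- The GNS-module consists of the operators that intertwine the action of the commutant of `B` on `G`
with the action `a ⊙ g ↦ a ⊙ b g` on `H`. The latter enters through all operators `h` that satisfy
this formula, so that its boundedness is not needed. -/
theorem mem_gnsModule_iff {x : G →L[ℂ] Space T} :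
    x ∈ gnsModule T ↔ ∀ b ∈ B.commutant, ∀ h : Space T →L[ℂ] Space T,
      (∀ a, h ∘L RKHS.kerFun (Space T) a = RKHS.kerFun (Space T) a ∘L b) → h ∘L x = x ∘L b := by
  constructor
  · intro hx b hb h hh
    have hS : ∀ y ∈ cyclicSpan T, h ∘L y = y ∘L b := fun y hy => by
      refine cyclicSpan_induction T (p := fun y => h ∘L y = y ∘L b)
        (fun a c => ?_) ?_ (fun y z hy hz => ?_) (fun r y hy => ?_) hy
      · have hc : (c : G →L[ℂ] G) ∘L b = b ∘L c :=
          VonNeumannAlgebra.mem_commutant_iff.mp hb c c.2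
        rw [ContinuousLinearMap.comp_assoc, hc, ← ContinuousLinearMap.comp_assoc, hh,
          ContinuousLinearMap.comp_assoc]
      · rw [ContinuousLinearMap.comp_zero, ContinuousLinearMap.zero_comp]
      · rw [ContinuousLinearMap.comp_add, hy, hz, ContinuousLinearMap.add_comp]
      · rw [ContinuousLinearMap.comp_smul, hy, ContinuousLinearMap.smul_comp]
    have hclosed : IsClosed {f : G → Space T | ∀ g, h (f g) = f (b g)} := by
      simp only [Set.ofPred_forall]
      exact isClosed_iInter fun g => isClosed_eq (by fun_prop) (by fun_prop)
    have hx' := closure_minimal (by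
      rintro _ ⟨y, hy, rfl⟩ g
      exact DFunLike.congr_fun (hS y hy) g) hclosed (mem_strongClosure.mp hx)
    ext1 g
    exact hx' g
  · intro hx
    refine mem_strongClosure_of_intertwines B (cyclicSpan T) (fun y hy b hb => ?_)
      (fun y hy z hz => adjoint_comp_mem T hy hz) fun b hb h hh => hx b hb h fun a => ?_
    · refine cyclicSpan_induction T (p := fun y => y ∘L b ∈ cyclicSpan T)
        (fun a c => ?_) ?_ (fun y z hy hz => ?_) (fun r y hy => ?_) hy
      · rw [ContinuousLinearMap.comp_assoc]
        exact kerFun_comp_mem_cyclicSpan T a (mul_mem c.2 hb)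
      · rw [ContinuousLinearMap.zero_comp]
        exact zero_mem _
      · rw [ContinuousLinearMap.add_comp]
        exact add_mem hy hz
      · rw [ContinuousLinearMap.smul_comp]
        exact Submodule.smul_mem _ r hy
    · exact hh _ (kerFun_mem_cyclicSpan T a)

/-! ### The commutator on the `C`-cyclic subspace -/

section Invariant

variable {C : VonNeumannAlgebra G} (hCB : C ≤ B)

/-- `D` extends the commutator `d ⊙ g ↦ c d ⊙ g - d ⊙ c g` with `c`, defined for `d ∈ C` and `g ∈ G`,
to all of `H`, by `0` on the orthogonal complement of the vectors `d ⊙ g` with `d ∈ C`. -/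
structure IsCommutatorExtension (c : C) (D : Space T →L[ℂ] Space T) : Prop where
  comp_kerFun : ∀ d : C, D ∘L RKHS.kerFun (Space T) (Set.inclusion hCB d) =
    RKHS.kerFun (Space T) (Set.inclusion hCB (c * d)) -
      RKHS.kerFun (Space T) (Set.inclusion hCB d) ∘L (c : G →L[ℂ] G)
  apply_eq_zero : ∀ y, (∀ d : C, (RKHS.kerFun (Space T) (Set.inclusion hCB d)).adjoint y = 0) →
    D y = 0

variable {T hCB}

theorem commute_adjoint_kerFun_comp (hcomm : ∀ x ∈ C, ∀ y ∈ C, x * y = y * x)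
    (hT : ∀ c : B, (c : G →L[ℂ] G) ∈ C → (T c : G →L[ℂ] G) ∈ C) (c d e : C) :
    Commute ((RKHS.kerFun (Space T) (Set.inclusion hCB d)).adjoint ∘L
      RKHS.kerFun (Space T) (Set.inclusion hCB e)) (c : G →L[ℂ] G) := by
  rw [adjoint_kerFun_comp_kerFun]
  exact hcomm _ (hT _ (star d * e).2) _ c.2

/-- As `T` leaves `C` invariant, `T (d⋆ e)` commutes with `c` for all `d, e ∈ C`. Therefore the right
multiplication `d ⊙ g ↦ d ⊙ c g` is bounded on the closed span of `C ⊙ G`. -/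
theorem exists_isCommutatorExtension (hcomm : ∀ x ∈ C, ∀ y ∈ C, x * y = y * x)
    (hT : ∀ c : B, (c : G →L[ℂ] G) ∈ C → (T c : G →L[ℂ] G) ∈ C) (c : C) :
    ∃ D, IsCommutatorExtension T hCB c D := by
  have hc := commute_adjoint_kerFun_comp (hCB := hCB) hcomm hT
  obtain ⟨R, hR, hR'⟩ := exists_comp_eq
    (fun d : C => RKHS.kerFun (Space T) (Set.inclusion hCB d)) c (hc c) (hc (star c))
  obtain ⟨P, hP, hP'⟩ := exists_comp_eq
    (fun d : C => RKHS.kerFun (Space T) (Set.inclusion hCB d)) 1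
    (fun _ _ => Commute.one_right _) (fun _ _ => by rw [star_one]; exact Commute.one_right _)
  refine ⟨leftRep T (Set.inclusion hCB c) ∘L P - R, fun d => ?_, fun y hy => ?_⟩
  · rw [ContinuousLinearMap.sub_comp, hR, ContinuousLinearMap.comp_assoc, hP,
      ← ContinuousLinearMap.comp_assoc, leftRep_kerFun]
    rfl
  · rw [sub_apply, ContinuousLinearMap.comp_apply, hP' y hy, hR' y hy, map_zero, sub_zero]

namespace IsCommutatorExtension

variable {c : C} {D : Space T →L[ℂ] Space T}

/-- The range of `D` is contained in the closed span of `C ⊙ G`. -/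
theorem adjoint_apply_eq_zero (hD : IsCommutatorExtension T hCB c D) {y : Space T}
    (hy : ∀ d : C, (RKHS.kerFun (Space T) (Set.inclusion hCB d)).adjoint y = 0) :
    D.adjoint y = 0 := by
  have h : innerSL ℂ y ∘L D = 0 := by
    refine ext_of_family (fun d : C => RKHS.kerFun (Space T) (Set.inclusion hCB d))
      (fun d => ?_) fun z hz => ?_
    · ext g
      simp only [ContinuousLinearMap.comp_assoc, hD.comp_kerFun]
      simp only [ContinuousLinearMap.comp_apply, sub_apply, innerSL_apply_apply,
        ← ContinuousLinearMap.adjoint_inner_left, inner_sub_right, hy]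
      simp
    · rw [ContinuousLinearMap.comp_apply, hD.apply_eq_zero z hz]
      simp
  refine ext_inner_right ℂ fun v => ?_
  rw [ContinuousLinearMap.adjoint_inner_left, inner_zero_left]
  exact DFunLike.congr_fun h v

theorem star_eq_adjoint (hcomm : ∀ x ∈ C, ∀ y ∈ C, x * y = y * x)
    (hT : ∀ c : B, (c : G →L[ℂ] G) ∈ C → (T c : G →L[ℂ] G) ∈ C)
    (hD : IsCommutatorExtension T hCB c D) {D' : Space T →L[ℂ] Space T}
    (hD' : IsCommutatorExtension T hCB (star c) D') : D' = D.adjoint := by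
  refine ext_of_family (fun d : C => RKHS.kerFun (Space T) (Set.inclusion hCB d))
    (fun d => ?_) fun y hy => ?_
  · rw [← ContinuousLinearMap.adjoint_adjoint (D' ∘L _),
      ← ContinuousLinearMap.adjoint_adjoint (D.adjoint ∘L _)]
    congr 1
    rw [ContinuousLinearMap.adjoint_comp D.adjoint, ContinuousLinearMap.adjoint_adjoint]
    refine ext_of_family (fun d : C => RKHS.kerFun (Space T) (Set.inclusion hCB d))
      (fun e => ?_) fun y hy => ?_
    · have hc := commute_adjoint_kerFun_comp (hCB := hCB) hcomm hT c d e
      rw [ContinuousLinearMap.comp_assoc, hD.comp_kerFun, hD'.comp_kerFun, map_sub,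
        ContinuousLinearMap.adjoint_comp, ContinuousLinearMap.sub_comp,
        ContinuousLinearMap.comp_sub, ContinuousLinearMap.comp_assoc,
        ← ContinuousLinearMap.comp_assoc _ _ (c : G →L[ℂ] G)]
      congr 1
      · rw [adjoint_kerFun_comp_kerFun, adjoint_kerFun_comp_kerFun]
        congr 2
        change star (Set.inclusion hCB (star c * d)) * _ = _ * Set.inclusion hCB (c * e)
        ext1
        change star (star (c : G →L[ℂ] G) * d) * (e : G →L[ℂ] G) = star (d : G →L[ℂ] G) * (c * e)
        rw [star_mul, star_star, mul_assoc]
      · refine Eq.trans ?_ hc.eq.symm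
        congr 1
        exact star_star (c : G →L[ℂ] G)
    · rw [ContinuousLinearMap.comp_apply, hD.apply_eq_zero y hy, map_zero, hD'.comp_kerFun,
        map_sub, ContinuousLinearMap.adjoint_comp]
      simp only [sub_apply, ContinuousLinearMap.comp_apply, hy]
      simp
  · rw [hD'.apply_eq_zero y hy, hD.adjoint_apply_eq_zero hy]

theorem comp_leftRep (hcomm : ∀ x ∈ C, ∀ y ∈ C, x * y = y * x)
    (hD : IsCommutatorExtension T hCB c D) (c' : C) :
    leftRep T (Set.inclusion hCB c') ∘L D = D ∘L leftRep T (Set.inclusion hCB c') := by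
  have hl : ∀ d : C, leftRep T (Set.inclusion hCB c') ∘L
      RKHS.kerFun (Space T) (Set.inclusion hCB d) =
        RKHS.kerFun (Space T) (Set.inclusion hCB (c' * d)) := fun d => leftRep_kerFun ..
  refine ext_of_family (fun d : C => RKHS.kerFun (Space T) (Set.inclusion hCB d))
    (fun d => ?_) fun y hy => ?_
  · have h : c' * (c * d) = c * (c' * d) := by
      rw [← mul_assoc, ← mul_assoc]
      congr 1
      exact Subtype.ext (hcomm _ c'.2 _ c.2)
    rw [ContinuousLinearMap.comp_assoc, ContinuousLinearMap.comp_assoc, hl, hD.comp_kerFun,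
      hD.comp_kerFun, ContinuousLinearMap.comp_sub, ← ContinuousLinearMap.comp_assoc, hl, hl, h]
  · rw [ContinuousLinearMap.comp_apply, ContinuousLinearMap.comp_apply, hD.apply_eq_zero y hy,
      map_zero, hD.apply_eq_zero]
    intro d
    rw [← ContinuousLinearMap.comp_apply, adjoint_kerFun_comp_leftRep]
    exact hy (star c' * d)

/-- `D` commutes with the action `a ⊙ g ↦ a ⊙ b g` of the commutant of `B`, hence maps the space of
intertwiners `E` into itself. -/
theorem comp_mem_gnsModule (hD : IsCommutatorExtension T hCB c D) {x : G →L[ℂ] Space T}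
    (hx : x ∈ gnsModule T) : D ∘L x ∈ gnsModule T := by
  rw [mem_gnsModule_iff] at hx ⊢
  intro b hb h hh
  have hDh : h ∘L D = D ∘L h := by
    refine ext_of_family (fun d : C => RKHS.kerFun (Space T) (Set.inclusion hCB d))
      (fun d => ?_) fun y hy => ?_
    · have hcb : (c : G →L[ℂ] G) ∘L b = b ∘L c :=
        VonNeumannAlgebra.mem_commutant_iff.mp hb c (hCB c.2)
      rw [ContinuousLinearMap.comp_assoc, ContinuousLinearMap.comp_assoc, hh,
        ← ContinuousLinearMap.comp_assoc D, hD.comp_kerFun, ContinuousLinearMap.comp_sub,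
        ContinuousLinearMap.sub_comp, hh, ← ContinuousLinearMap.comp_assoc, hh,
        ContinuousLinearMap.comp_assoc, ContinuousLinearMap.comp_assoc, hcb]
    · rw [ContinuousLinearMap.comp_apply, ContinuousLinearMap.comp_apply, hD.apply_eq_zero y hy,
        map_zero, hD.apply_eq_zero]
      intro d
      rw [← ContinuousLinearMap.comp_apply, adjoint_kerFun_comp T hb hh,
        ContinuousLinearMap.comp_apply, hy, map_zero]
  rw [← ContinuousLinearMap.comp_assoc, hDh, ContinuousLinearMap.comp_assoc, hx b hb h hh,
    ContinuousLinearMap.comp_assoc]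

end IsCommutatorExtension

end Invariant
end CPMap

/-! ### Invariance of `C` and existence of `α` -/

/-- Substituting `ξ d = d ξ - α(d) ξ` into `T(c) d = ⟪ξ, c ξ d⟫` and into `d T(c) = ⟪ξ d⋆, c ξ⟫` yields
the same element, so `T(c)` commutes with `C`. -/
theorem CPMap.map_mem_of_exists {G : Type*} [NormedAddCommGroup G] [InnerProductSpace ℂ G]
    [CompleteSpace G] {B : VonNeumannAlgebra G} {T : B →CP B} {C : VonNeumannAlgebra G}
    (hC : C.IsMaximalCommutative B) (α : C → AdjointableOperator (CPMap.gnsModule T))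
    (hstar : ∀ c : C, α (star c) = star (α c))
    (hcomm : ∀ (c₁ c₂ : C) (x : CPMap.gnsModule T),
      CPMap.leftMul T (Set.inclusion hC.prop.1 c₁) (α c₂ x) =
        α c₂ (CPMap.leftMul T (Set.inclusion hC.prop.1 c₁) x))
    (hξ : ∀ c : C, α c (CPMap.cyclicVector T) =
      CPMap.leftMul T (Set.inclusion hC.prop.1 c) (CPMap.cyclicVector T) -
        CPMap.rightMul T (CPMap.cyclicVector T) (Set.inclusion hC.prop.1 c))
    (c : B) (hc : (c : G →L[ℂ] G) ∈ C) : (T c : G →L[ℂ] G) ∈ C := by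
  refine hC.mem_of_commute (T c).2 fun d hd => ?_
  have hξ' : ∀ e : C, cyclicOp T ∘L (e : G →L[ℂ] G) =
      RKHS.kerFun (Space T) (Set.inclusion hC.prop.1 e) - α e (cyclicVector T) := fun e => by
    rw [hξ e, ← leftRep_cyclicOp]
    exact (sub_sub_cancel _ _).symm
  have hξl : ∀ b : B, (leftMul T b (cyclicVector T) : G →L[ℂ] Space T) =
      RKHS.kerFun (Space T) b := fun b => leftRep_cyclicOp T b
  set c' : C := ⟨c, hc⟩
  set d' : C := ⟨d, hd⟩
  have hTc : (T c : G →L[ℂ] G) = (cyclicOp T).adjoint ∘L RKHS.kerFun (Space T) c := by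
    rw [cyclicOp, adjoint_kerFun_comp_kerFun, star_one, one_mul]
  -- `⟪α(d⋆) ξ, c ξ⟫ = ⟪ξ, α(d) (c ξ)⟫ = ⟪ξ, c α(d) ξ⟫`
  have hα : (α (star d') (cyclicVector T) : G →L[ℂ] Space T).adjoint ∘L
      RKHS.kerFun (Space T) c = (cyclicOp T).adjoint ∘L leftRep T c ∘L
        (α d' (cyclicVector T) : G →L[ℂ] Space T) := by
    have h := (α d').inner_adj (cyclicVector T) (leftMul T c (cyclicVector T))
    have h2 : α (star d') (cyclicVector T) = (α d').adj (cyclicVector T) := by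
      rw [hstar]
      rfl
    rw [hξl] at h
    rw [h2]
    refine h.trans ?_
    congr 1
    exact congrArg Subtype.val (hcomm c' d' (cyclicVector T)).symm
  have hleft : d * (T c : G →L[ℂ] G) = (T (Set.inclusion hC.prop.1 d' * c) : G →L[ℂ] G) -
      (α (star d') (cyclicVector T) : G →L[ℂ] Space T).adjoint ∘L RKHS.kerFun (Space T) c := by
    have h : d * (T c : G →L[ℂ] G) =
        (cyclicOp T ∘L ((star d' : C) : G →L[ℂ] G)).adjoint ∘L RKHS.kerFun (Space T) c := by
      rw [ContinuousLinearMap.adjoint_comp, ContinuousLinearMap.comp_assoc, ← hTc]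
      congr 1
      exact (star_star d).symm
    rw [h, hξ', map_sub, ContinuousLinearMap.sub_comp, adjoint_kerFun_comp_kerFun]
    congr 4
    exact Subtype.ext (star_star d)
  have hright : (T c : G →L[ℂ] G) * d = (T (c * Set.inclusion hC.prop.1 d') : G →L[ℂ] G) -
      (cyclicOp T).adjoint ∘L leftRep T c ∘L (α d' (cyclicVector T) : G →L[ℂ] Space T) := by
    have h : (T c : G →L[ℂ] G) * d =
        (cyclicOp T).adjoint ∘L leftRep T c ∘L cyclicOp T ∘L (d' : G →L[ℂ] G) := by
      rw [hTc, ← leftRep_cyclicOp]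
      rfl
    rw [h, hξ', ContinuousLinearMap.comp_sub, ContinuousLinearMap.comp_sub, leftRep_kerFun,
      cyclicOp, adjoint_kerFun_comp_kerFun, star_one, one_mul]
  have hcd : Set.inclusion hC.prop.1 d' * c = c * Set.inclusion hC.prop.1 d' :=
    Subtype.ext (hC.prop.2 d hd c hc)
  rw [hleft, hright, hα, hcd]

theorem theorem3p1 {G : Type*} [NormedAddCommGroup G] [InnerProductSpace ℂ G] [CompleteSpace G]
    (B : VonNeumannAlgebra G) (T : B →CP B) (hT : CPMap.IsNormal T)
    (C : VonNeumannAlgebra G) (hC : C.IsMaximalCommutative B) :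
    (∀ c : B, (c : G →L[ℂ] G) ∈ C → (T c : G →L[ℂ] G) ∈ C) ↔
      ∃ α : C → AdjointableOperator (CPMap.gnsModule T),
        (∀ c : C, α (star c) = star (α c)) ∧
        (∀ (c₁ c₂ : C) (x : CPMap.gnsModule T),
          CPMap.leftMul T (Set.inclusion hC.prop.1 c₁) (α c₂ x) =
            α c₂ (CPMap.leftMul T (Set.inclusion hC.prop.1 c₁) x)) ∧
        (∀ c : C, α c (CPMap.cyclicVector T) =
          CPMap.leftMul T (Set.inclusion hC.prop.1 c) (CPMap.cyclicVector T) -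
            CPMap.rightMul T (CPMap.cyclicVector T) (Set.inclusion hC.prop.1 c)) := by
  constructor
  · intro hTC
    choose D hD using CPMap.exists_isCommutatorExtension (hCB := hC.prop.1) hC.prop.2 hTC
    have hadj : ∀ c, D (star c) = (D c).adjoint := fun c =>
      (hD c).star_eq_adjoint hC.prop.2 hTC (hD (star c))
    refine ⟨fun c =>
      { toFun := fun x => ⟨D c ∘L x, (hD c).comp_mem_gnsModule x.2⟩
        adj := fun x => ⟨D (star c) ∘L x, (hD (star c)).comp_mem_gnsModule x.2⟩
        inner_adj := fun x y => ?_ }, fun c => ?_, fun c₁ c₂ x => ?_, fun c => ?_⟩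
    · change (D (star c) ∘L (x : G →L[ℂ] CPMap.Space T)).adjoint ∘L
          (y : G →L[ℂ] CPMap.Space T) =
        (x : G →L[ℂ] CPMap.Space T).adjoint ∘L D c ∘L (y : G →L[ℂ] CPMap.Space T)
      rw [hadj, ContinuousLinearMap.adjoint_comp, ContinuousLinearMap.adjoint_adjoint,
        ContinuousLinearMap.comp_assoc]
    · ext1 x
      rfl
    · refine Subtype.ext ?_
      exact congrArg (· ∘L (x : G →L[ℂ] CPMap.Space T)) ((hD c₂).comp_leftRep hC.prop.2 c₁)
    · refine Subtype.ext ?_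
      -- `ξ = 1 ⊙ ·`, and the defining relation of `D c` is used at `1 ∈ C`
      refine ((hD c).comp_kerFun 1).trans ?_
      rw [mul_one]
      congr 1
      exact (CPMap.leftRep_cyclicOp T _).symm
  · rintro ⟨α, hstar, hcomm, hξ⟩
    exact CPMap.map_mem_of_exists hC α hstar hcomm hξ
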